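/- **Theorem 2.1.** For $N\ge 2$ let $\mathbb T_N=\mathbb Z/N\mathbb Z$ and $\Sigma_N=\{0,1\}^{\mathbb T_N}$; write $|\eta|=\sum_{x\in\mathbb T_N}\eta_x$ for $\eta\in\Sigma_N$. The facilitated exclusion process (FEP) on $\mathbb T_N$ is the continuous-time Markov chain $(\eta(t))_{t\ge 0}$ on $\Sigma_N$ with generator $$\mathscr L_N f(\eta)=\sum_{x\in\mathbb T_N}c_{x,x+1}(\eta)\,\{f(\eta^{x,x+1})-f(\eta)\},\qquad c_{x,x+1}(\eta)=\eta_{x-1}\eta_x(1-\eta_{x+1})+(1-\eta_x)\eta_{x+1}\eta_{x+2},$$ where $\eta^{x,x+1}$ is obtained from $\eta$ by exchanging the values at $x$ and $x+1$. Let $\mathbb P^N_\eta$ denote its law when started from $\eta\in\Sigma_N$. Let $$\mathcal F_N=\{\eta\in\Sigma_N:\ \eta_x\eta_{x+1}=0\ \ \forall x\in\mathbb T_N\},\qquad \mathcal E_N=\{\eta\in\Sigma_N:\ (1-\eta_x)(1-\eta_{x+1})=0\ \ \forall x\in\mathbb T_N\}$$ be the sets of frozen and of ergodic configurations, and let $$\mathcal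 T_N=\{\eta\in\Sigma_N\setminus\mathcal F_N:\ |\eta|\le N/2\}\cup\{\eta\in\Sigma_N\setminus\mathcal E_N:\ |\eta|\ge N/2\}$$ be the set of transient configurations. Set $p_N(t)=\sup_{\eta\in\Sigma_N}\mathbb P^N_\eta\big(\eta(t)\in\mathcal T_N\big)$ for $t\ge 0$. Then $$\lim_{t\to\infty}\ \sup_{N\ge 2}\ p_N\big(tN^2\log N\big)=0 .$$ -/

import Mathlib

open Filter Topology MeasureTheory
open scoped ENNReal

namespace FEP

/-- Configurations `η ∈ {0,1}^{𝕋_N}` on the ring `𝕋_N = ℤ/Nℤ`; `η x = true` means that the site `x`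
is occupied by a particle. -/
abbrev Config (N : ℕ) : Type := ZMod N → Bool

section Ring

variable {N : ℕ}

/-- The occupation number `η_x ∈ {0,1}`, as a real number. -/
def occ (η : Config N) (x : ZMod N) : ℝ := if η x then 1 else 0

/-- The jump rate `c_{x,x+1}(η) = η_{x-1} η_x (1 - η_{x+1}) + (1 - η_x) η_{x+1} η_{x+2}`. -/
def rate (η : Config N) (x : ZMod N) : ℝ :=
  occ η (x - 1) * occ η x * (1 - occ η (x + 1)) + (1 - occ η x) * occ η (x + 1) * occ η (x + 2)

/-- The configuration `η^{x,x+1}`, where the contents of the sites `x` and `x+1` are exchanged. -/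
def exchange (η : Config N) (x : ZMod N) : Config N := fun y => η (Equiv.swap x (x + 1) y)

end Ring

section Chain

variable (N : ℕ) [NeZero N]

/-- The Markov generator of the facilitated exclusion process,
`(L f)(η) = ∑_{x ∈ 𝕋_N} c_{x,x+1}(η) (f(η^{x,x+1}) - f(η))`. -/
noncomputable def generator : (Config N → ℝ) →ₗ[ℝ] (Config N → ℝ) where
  toFun f η := ∑ x : ZMod N, rate η x * (f (exchange η x) - f η)
  map_add' f g := by
    ext η
    simp only [Pi.add_apply, ← Finset.sum_add_distrib]
    exact Finset.sum_congr rfl fun x _ => by ring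
  map_smul' a f := by
    ext η
    simp only [Pi.smul_apply, smul_eq_mul, RingHom.id_apply, Finset.mul_sum]
    exact Finset.sum_congr rfl fun x _ => by ring

/-- The Markov semigroup `e^{tL}` generated by `L`, acting on functions on the (finite) state
space. -/
noncomputable def semigroup (t : ℝ) : (Config N → ℝ) →L[ℝ] (Config N → ℝ) :=
  NormedSpace.exp (t • LinearMap.toContinuousLinearMap (generator N))

theorem occ_mem {N : ℕ} (η : Config N) (x : ZMod N) : occ η x = 0 ∨ occ η x = 1 := by
  unfold occ; split <;> simp

theorem rate_nonneg {N : ℕ} (η : Config N) (x : ZMod N) : 0 ≤ rate η x := by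
  unfold rate
  rcases occ_mem η (x - 1) with h1 | h1 <;> rcases occ_mem η x with h2 | h2 <;>
    rcases occ_mem η (x + 1) with h3 | h3 <;> rcases occ_mem η (x + 2) with h4 | h4 <;>
    norm_num [h1, h2, h3, h4]

theorem rate_le_one {N : ℕ} (η : Config N) (x : ZMod N) : rate η x ≤ 1 := by
  unfold rate
  rcases occ_mem η (x - 1) with h1 | h1 <;> rcases occ_mem η x with h2 | h2 <;>
    rcases occ_mem η (x + 1) with h3 | h3 <;> rcases occ_mem η (x + 2) with h4 | h4 <;>
    norm_num [h1, h2, h3, h4]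

theorem semigroup_zero : semigroup N 0 = 1 := by
  simp [semigroup]

/-- Kolmogorov equation: `d/dt e^{tL} f = e^{tL} L f`. -/
theorem hasDerivAt_semigroup (f : Config N → ℝ) (η : Config N) (t : ℝ) :
    HasDerivAt (fun s => semigroup N s f η) (semigroup N t (generator N f) η) t := by
  have h := hasDerivAt_exp_smul_const (𝕂 := ℝ) (LinearMap.toContinuousLinearMap (generator N)) t
  have h2 := h.clm_apply (hasDerivAt_const t f)
  have h3 := (hasDerivAt_pi.1 h2) η
  simpa [semigroup] using h3

theorem semigroup_one (t : ℝ) : semigroup N t 1 = 1 := by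
  have h0 : generator N 1 = 0 := by
    ext η; simp [generator]
  ext η
  have hd : ∀ s, HasDerivAt (fun s => semigroup N s 1 η) 0 s := fun s => by
    simpa [h0] using hasDerivAt_semigroup N 1 η s
  have := is_const_of_deriv_eq_zero (fun s => (hd s).differentiableAt) (fun s => (hd s).deriv) t 0
  simpa [semigroup_zero] using this

/-- The semigroup preserves non-negativity. -/
theorem semigroup_nonneg {t : ℝ} (ht : 0 ≤ t) {f : Config N → ℝ} (hf : ∀ η, 0 ≤ f η)
    (η : Config N) : 0 ≤ semigroup N t f η := by
  set A := LinearMap.toContinuousLinearMap (generator N) with hA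
  set B : (Config N → ℝ) →L[ℝ] (Config N → ℝ) := A + (N : ℝ) • 1 with hB
  have hBpos : ∀ g : Config N → ℝ, (∀ η, 0 ≤ g η) → ∀ η, 0 ≤ (t • B) g η := by
    intro g hg η
    have : (t • B) g η =
        t * ∑ x : ZMod N, (rate η x * g (exchange η x) + (1 - rate η x) * g η) := by
      have hN : (N : ℝ) * g η = ∑ _x : ZMod N, g η := by
        simp [ZMod.card]
      simp only [hB, hA, smul_apply, add_apply, Pi.smul_apply, Pi.add_apply,
        one_apply_eq_self, smul_eq_mul, LinearMap.coe_toContinuousLinearMap',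
        generator, LinearMap.coe_mk, AddHom.coe_mk, hN, ← Finset.sum_add_distrib]
      congr 1
      exact Finset.sum_congr rfl fun x _ => by ring
    rw [this]
    refine mul_nonneg ht (Finset.sum_nonneg fun x _ => add_nonneg ?_ ?_)
    · exact mul_nonneg (rate_nonneg η x) (hg _)
    · exact mul_nonneg (sub_nonneg.2 (rate_le_one η x)) (hg _)
  have hpow : ∀ (n : ℕ) (η : Config N), 0 ≤ ((t • B) ^ n) f η := by
    intro n
    induction n with
    | zero => simpa using hf
    | succ n ih =>
      intro η
      rw [pow_succ']
      exact hBpos _ ih η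
  have hexp : 0 ≤ NormedSpace.exp (t • B) f η := by
    have hs := NormedSpace.exp_series_hasSum_exp' (𝕂 := ℝ) (t • B)
    have hs2 := (ContinuousLinearMap.apply ℝ (Config N → ℝ) f).hasSum hs
    have hs3 := (Pi.hasSum.1 hs2) η
    refine hs3.nonneg fun n => ?_
    simpa using mul_nonneg (by positivity) (hpow n η)
  have hsplit : semigroup N t = Real.exp (-(t * N)) • NormedSpace.exp (t • B) := by
    have h1 : t • A = (-(t * N)) • (1 : (Config N → ℝ) →L[ℝ] (Config N → ℝ)) + t • B := by
      rw [hB]; module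
    have hc : Commute ((-(t * N)) • (1 : (Config N → ℝ) →L[ℝ] (Config N → ℝ))) (t • B) :=
      (Commute.one_left _).smul_left _
    have h2 : NormedSpace.exp ((-(t * N)) • (1 : (Config N → ℝ) →L[ℝ] (Config N → ℝ))) =
        Real.exp (-(t * N)) • (1 : (Config N → ℝ) →L[ℝ] (Config N → ℝ)) := by
      have := NormedSpace.algebraMap_exp_comm (𝕂 := ℝ)
        (𝔸 := (Config N → ℝ) →L[ℝ] (Config N → ℝ)) (-(t * N))
      rw [Algebra.algebraMap_eq_smul_one, Algebra.algebraMap_eq_smul_one] at this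
      rw [← this, Real.exp_eq_exp_ℝ]
    let _ : NormedAlgebra ℚ ((Config N → ℝ) →L[ℝ] (Config N → ℝ)) :=
      NormedAlgebra.restrictScalars ℚ ℝ _
    rw [semigroup, ← hA, h1, NormedSpace.exp_add_of_commute hc, h2, smul_mul_assoc, one_mul]
  rw [hsplit]
  simpa using mul_nonneg (Real.exp_pos _).le hexp

/-- The transition probability `ℙ_η(η(t) = η') = (e^{tL} 1_{η'})(η)`. -/
noncomputable def transition (t : ℝ) (η η' : Config N) : ℝ :=
  semigroup N t (Pi.single η' 1) η

theorem transition_nonneg {t : ℝ} (ht : 0 ≤ t) (η η' : Config N) : 0 ≤ transition N t η η' :=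
  semigroup_nonneg N ht (fun ζ => by by_cases h : ζ = η' <;> simp [h]) η

theorem sum_transition_mul (t : ℝ) (η : Config N) (f : Config N → ℝ) :
    ∑ η', transition N t η η' * f η' = semigroup N t f η := by
  have hf : f = ∑ η', f η' • (Pi.single η' 1 : Config N → ℝ) := by
    ext ζ; simp [Finset.sum_apply, Pi.single_apply]
  conv_rhs => rw [hf, map_sum, Finset.sum_apply]
  exact Finset.sum_congr rfl fun η' _ => by simp [transition, mul_comm]

/-- The law of `η(t)`, where `η(·)` is the continuous-time Markov chain with generator `L` started
from `η`. -/
noncomputable def law (η : Config N) (t : ℝ) : Measure (Config N) :=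
  ∑ η' : Config N, ENNReal.ofReal (transition N t η η') • Measure.dirac η'

theorem law_zero (η : Config N) : law N η 0 = Measure.dirac η := by
  unfold law
  rw [Finset.sum_eq_single η]
  · simp [transition, semigroup_zero]
  · intro b _ hb
    simp [transition, semigroup_zero, hb.symm]
  · simp

theorem isProbabilityMeasure_law (η : Config N) {t : ℝ} (ht : 0 ≤ t) :
    IsProbabilityMeasure (law N η t) := by
  constructor
  have h := sum_transition_mul N t η 1
  simp only [Pi.one_apply, mul_one, semigroup_one] at h
  simp only [law, Measure.finsetSum_apply, Measure.smul_apply, measure_univ, smul_eq_mul, mul_one]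
  rw [← ENNReal.ofReal_sum_of_nonneg fun η' _ => transition_nonneg N ht η η', h]
  simp

/-- `𝔼_η[f(η(t))] = (e^{tL} f)(η)`. -/
theorem integral_law (η : Config N) {t : ℝ} (ht : 0 ≤ t) (f : Config N → ℝ) :
    ∫ ζ, f ζ ∂(law N η t) = semigroup N t f η := by
  have (ζ : Config N) : IsFiniteMeasure (ENNReal.ofReal (transition N t η ζ) • Measure.dirac ζ) :=
    Measure.smul_finite _ ENNReal.ofReal_ne_top
  rw [law, integral_finsetSum_measure fun i _ => Integrable.of_finite, ← sum_transition_mul]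
  refine Finset.sum_congr rfl fun η' _ => ?_
  rw [integral_smul_measure, integral_dirac, ENNReal.toReal_ofReal (transition_nonneg N ht η η'),
    smul_eq_mul]

/-- The number of particles `|η|`. -/
def numParticles {N : ℕ} [NeZero N] (η : Config N) : ℕ :=
  (Finset.univ.filter fun x : ZMod N => η x = true).card

/-- Frozen configurations: no two neighbouring particles. -/
def frozen : Set (Config N) := {η | ∀ x, occ η x * occ η (x + 1) = 0}

/-- Ergodic configurations: no two neighbouring empty sites. -/
def ergodic : Set (Config N) := {η | ∀ x, (1 - occ η x) * (1 - occ η (x + 1)) = 0}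

/-- Subcritical transient configurations: not frozen, with `|η| ≤ N/2`. -/
def transientSub : Set (Config N) := {η | η ∉ frozen N ∧ (numParticles η : ℝ) ≤ (N : ℝ) / 2}

/-- Supercritical transient configurations: not ergodic, with `|η| ≥ N/2`. -/
def transientSuper : Set (Config N) := {η | η ∉ ergodic N ∧ (N : ℝ) / 2 ≤ (numParticles η : ℝ)}

/-- Transient configurations. -/
def transient : Set (Config N) := transientSub N ∪ transientSuper N

/-- `p_η(t)`, the probability that the process started from `η` is still transient at time `t`. -/
noncomputable def transienceProb (η : Config N) (t : ℝ) : ℝ≥0∞ := law N η t (transient N)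

/-- The maximal transience probability `p_N(t) = sup_η p_η(t)`. -/
noncomputable def maxTransienceProb (t : ℝ) : ℝ≥0∞ := ⨆ η : Config N, transienceProb N η t

end Chain

instance neZeroOfTwoLE (N : {n : ℕ // 2 ≤ n}) : NeZero (N : ℕ) :=
  ⟨by have := N.2; omega⟩

end FEP

namespace FEP

/-! ### Exponential decay from a Lyapunov function -/

section Lyapunov

variable {N : ℕ} [NeZero N]

/-! Cut the ring at an empty pair `x`, `x + 1` and number the particles from there; adjacent
particles k and k + 1 form a pair of index k. A jump destroys one pair and creates at most one,
whose index is one higher or lower. With T particles, the weight k(T - k) vanishes at k = 0 and k =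
T and has second difference -2, so the weighted number of pairs has drift at most -2 times the
number of pairs (`sum_drift`). As the weights are at most N², this is at most -2/N² times the
weighted number itself.

Empty pairs are never created (`trap_exchange_eq_zero`), and the loss of one only removes its
energy. Hence the estimate survives multiplication by the indicator `trap` and summation over `x`
(`generator_lyapunov_le`). The sum is at most N⁴, and at least 1 on transient configurations, which
contain both an empty pair and a particle pair (`one_le_lyapunov`). Grönwall and Markov give p_N(t)
≤ N⁴ exp(-2t/N²), and time tN² log N turns this into N^(4 - 2t). -/

theorem semigroup_mono {t : ℝ} (ht : 0 ≤ t) {f g : Config N → ℝ} (h : ∀ η, f η ≤ g η)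
    (η : Config N) : semigroup N t f η ≤ semigroup N t g η := by
  have := semigroup_nonneg N ht (f := g - f) (fun η => sub_nonneg.2 (h η)) η
  rw [map_sub] at this
  exact sub_nonneg.1 this

/-- Grönwall: by positivity of the semigroup, `exp (c * s)` times the expectation of `f` at time `s`
is nonincreasing. -/
theorem semigroup_le_exp_mul {f : Config N → ℝ} {c : ℝ}
    (h : ∀ η, generator N f η ≤ -c * f η) {t : ℝ} (ht : 0 ≤ t) (η : Config N) :
    semigroup N t f η ≤ Real.exp (-c * t) * f η := by
  have hd : ∀ s, HasDerivAt (fun s => Real.exp (c * s) * semigroup N s f η)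
      (Real.exp (c * s) * semigroup N s (c • f + generator N f) η) s := fun s => by
    have h1 : HasDerivAt (fun s => Real.exp (c * s)) (Real.exp (c * s) * c) s := by
      simpa using ((hasDerivAt_id s).const_mul c).exp
    refine (h1.mul (hasDerivAt_semigroup N f η s)).congr_deriv ?_
    simp only [map_add, map_smul, Pi.add_apply, Pi.smul_apply, smul_eq_mul]
    ring
  have hanti : AntitoneOn (fun s => Real.exp (c * s) * semigroup N s f η) (Set.Ici 0) := by
    refine antitoneOn_of_deriv_nonpos (convex_Ici 0)
      (fun s _ => (hd s).continuousAt.continuousWithinAt)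
      (fun s _ => (hd s).differentiableAt.differentiableWithinAt) fun s hs => ?_
    rw [interior_Ici] at hs
    rw [(hd s).deriv]
    refine mul_nonpos_of_nonneg_of_nonpos (Real.exp_pos _).le ?_
    have := semigroup_mono (N := N) (le_of_lt hs) (f := c • f + generator N f) (g := 0)
      (fun ζ => by
        have := h ζ
        simp only [Pi.add_apply, Pi.smul_apply, smul_eq_mul, Pi.zero_apply]
        linarith) η
    simpa using this
  have h0 := hanti (Set.mem_Ici.2 le_rfl) (Set.mem_Ici.2 ht) ht
  simp only [mul_zero, Real.exp_zero, one_mul, semigroup_zero, one_apply_eq_self] at h0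
  calc semigroup N t f η
      = Real.exp (-c * t) * (Real.exp (c * t) * semigroup N t f η) := by
        rw [← mul_assoc, ← Real.exp_add]; simp
    _ ≤ _ := mul_le_mul_of_nonneg_left h0 (Real.exp_pos _).le

theorem law_le_ofReal_semigroup {t : ℝ} (ht : 0 ≤ t) (η : Config N) {S : Set (Config N)}
    {f : Config N → ℝ} (hf : ∀ ζ, 0 ≤ f ζ) (hS : ∀ ζ ∈ S, 1 ≤ f ζ) :
    law N η t S ≤ ENNReal.ofReal (semigroup N t f η) := by
  have := isProbabilityMeasure_law N η ht
  have hm : MeasurableSet S := S.toFinite.measurableSet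
  rw [← ENNReal.ofReal_toReal (measure_ne_top (law N η t) S)]
  refine ENNReal.ofReal_le_ofReal ?_
  have h1 : (law N η t S).toReal = ∫ ζ, S.indicator 1 ζ ∂(law N η t) := by
    rw [integral_indicator_one hm]; rfl
  rw [h1, integral_law N η ht]
  refine semigroup_mono ht (fun ζ => ?_) η
  by_cases h : ζ ∈ S
  · simpa [h] using hS ζ h
  · simpa [h] using hf ζ

end Lyapunov

/-! ### Occupation numbers and particle counts on arcs -/

section Occ

variable {N : ℕ}

theorem occ_nonneg (η : Config N) (x : ZMod N) : 0 ≤ occ η x := by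
  rcases occ_mem η x with h | h <;> simp [h]

theorem occ_le_one (η : Config N) (x : ZMod N) : occ η x ≤ 1 := by
  rcases occ_mem η x with h | h <;> simp [h]

theorem occ_exchange_left (η : Config N) (z : ZMod N) : occ (exchange η z) z = occ η (z + 1) := by
  simp [occ, exchange]

theorem occ_exchange_right (η : Config N) (z : ZMod N) : occ (exchange η z) (z + 1) = occ η z := by
  simp [occ, exchange]

theorem occ_exchange_of_ne (η : Config N) {z y : ZMod N} (h : y ≠ z) (h' : y ≠ z + 1) :
    occ (exchange η z) y = occ η y := by
  simp [occ, exchange, Equiv.swap_apply_of_ne_of_ne h h']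

/-- The indicator that both `x` and `x + 1` are empty. -/
noncomputable def trap (x : ZMod N) (η : Config N) : ℝ := (1 - occ η x) * (1 - occ η (x + 1))

theorem trap_mem (x : ZMod N) (η : Config N) : trap x η = 0 ∨ trap x η = 1 := by
  unfold trap
  rcases occ_mem η x with h | h <;> rcases occ_mem η (x + 1) with h' | h' <;> simp [h, h']

theorem occ_mul_nonneg (η : Config N) (y : ZMod N) : 0 ≤ occ η y * occ η (y + 1) :=
  mul_nonneg (occ_nonneg _ _) (occ_nonneg _ _)

theorem occ_mul_le_one (η : Config N) (y : ZMod N) : occ η y * occ η (y + 1) ≤ 1 :=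
  mul_le_one₀ (occ_le_one _ _) (occ_nonneg _ _) (occ_le_one _ _)

theorem trap_nonneg (x : ZMod N) (η : Config N) : 0 ≤ trap x η :=
  mul_nonneg (sub_nonneg.2 (occ_le_one _ _)) (sub_nonneg.2 (occ_le_one _ _))

/-- The two terms of the rate are exclusive indicators, of a jump to the right and of one to the
left, so the increment can be bounded separately for each; `a` and `b` may have any sign. -/
theorem rate_mul_le {η : Config N} {z : ZMod N} {d a b : ℝ}
    (ha : occ η (z - 1) = 1 → occ η z = 1 → occ η (z + 1) = 0 → d ≤ a)
    (hb : occ η z = 0 → occ η (z + 1) = 1 → occ η (z + 2) = 1 → d ≤ b) :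
    rate η z * d ≤ occ η (z - 1) * occ η z * (1 - occ η (z + 1)) * a
      + (1 - occ η z) * occ η (z + 1) * occ η (z + 2) * b := by
  unfold rate
  rcases occ_mem η (z - 1) with h1 | h1 <;> rcases occ_mem η z with h2 | h2 <;>
    rcases occ_mem η (z + 1) with h3 | h3 <;> rcases occ_mem η (z + 2) with h4 | h4 <;>
    simp_all

/-- A jump never creates a pair of neighbouring empty sites. -/
theorem trap_exchange_eq_zero {x z : ZMod N} {η : Config N} (ht : trap x η = 0)
    (h : (occ η (z - 1) = 1 ∧ occ η z = 1 ∧ occ η (z + 1) = 0) ∨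
      (occ η z = 0 ∧ occ η (z + 1) = 1 ∧ occ η (z + 2) = 1)) :
    trap x (exchange η z) = 0 := by
  have e2 : z + 1 + 1 = z + 2 := by ring
  by_cases hz : x = z
  · subst hz
    rw [trap, occ_exchange_left, occ_exchange_right]
    rcases h with ⟨-, h1, h2⟩ | ⟨h1, h2, -⟩ <;> simp [h1, h2]
  by_cases hz1 : x = z + 1
  · subst hz1
    rcases h with ⟨-, h1, -⟩ | ⟨h0, h1, h2⟩
    · simp [trap, occ_exchange_right, h1]
    -- The vacated site is `x = z + 1`; the facilitating particle at `z + 2` stays put.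
    · have n1 : z + 2 ≠ z := fun h => by rw [h, h0] at h2; exact zero_ne_one h2
      have n2 : z + 2 ≠ z + 1 := fun h => hz (by linear_combination h)
      rw [trap, e2, occ_exchange_of_ne η n1 n2, h2, sub_self, mul_zero]
  by_cases hz2 : x + 1 = z
  · subst hz2
    rcases h with ⟨h0, h1, h2⟩ | ⟨-, h1, -⟩
    · rw [add_sub_cancel_right] at h0
      rw [trap, occ_exchange_of_ne η hz hz1, h0, sub_self, zero_mul]
    · simp [trap, occ_exchange_left, h1]
  · rw [trap, occ_exchange_of_ne η hz hz1, occ_exchange_of_ne η hz2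
      (fun h => hz (add_right_cancel h))]
    exact ht

/-- The position of `z` on the ring cut between `x` and `x + 1`. -/
def pos (x z : ZMod N) : ℕ := (z - (x + 1)).val

variable [NeZero N]

theorem pos_add_one {x z : ZMod N} (h : z ≠ x) : pos x (z + 1) = pos x z + 1 := by
  have h1 : z + 1 - (x + 1) = z - (x + 1) + 1 := by ring
  have hlt := ZMod.val_lt (z - (x + 1))
  -- Only `x` itself occupies the last position.
  have hne : (z - (x + 1)).val ≠ N - 1 := fun he => h <| by
    have h2 : ((z - (x + 1)).val : ZMod N) = ((N - 1 : ℕ) : ZMod N) := by rw [he]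
    rw [ZMod.natCast_zmod_val, Nat.cast_sub (Nat.one_le_iff_ne_zero.2 (NeZero.ne N))] at h2
    simp only [CharP.cast_eq_zero, Nat.cast_one, zero_sub] at h2
    linear_combination h2
  have h3 : (z - (x + 1)).val + 1 < N := by omega
  unfold pos
  rw [h1, ← ZMod.val_natCast_of_lt h3]
  simp

theorem pos_injective (x : ZMod N) : Function.Injective (pos x) := fun a b h => by
  simpa using ZMod.val_injective N h

/-- The number of particles on the whole ring. -/
noncomputable def total (η : Config N) : ℝ := ∑ z : ZMod N, occ η z

/-- The number of particles on the arc `{x+1, …, y}`. -/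
noncomputable def arc (x : ZMod N) (η : Config N) (y : ZMod N) : ℝ :=
  ∑ z : ZMod N, if pos x z ≤ pos x y then occ η z else 0

theorem arc_add_one {x y : ZMod N} (η : Config N) (h : y ≠ x) :
    arc x η (y + 1) = arc x η y + occ η (y + 1) := by
  have : occ η (y + 1) = ∑ z : ZMod N, if z = y + 1 then occ η z else 0 := by simp
  rw [arc, arc, this, ← Finset.sum_add_distrib]
  refine Finset.sum_congr rfl fun z _ => ?_
  rw [pos_add_one h]
  by_cases hz : z = y + 1
  · subst hz
    simp [pos_add_one h]
  · have : pos x z ≠ pos x y + 1 := fun he => hz (pos_injective x (he.trans (pos_add_one h).symm))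
    have : pos x z ≤ pos x y + 1 ↔ pos x z ≤ pos x y := by omega
    simp [this, hz]

theorem occ_le_arc (x : ZMod N) (η : Config N) (y : ZMod N) : occ η y ≤ arc x η y := by
  have := Finset.single_le_sum (s := Finset.univ)
    (f := fun z => if pos x z ≤ pos x y then occ η z else 0)
    (fun z _ => by split_ifs; exacts [occ_nonneg η z, le_rfl]) (Finset.mem_univ y)
  simpa [arc] using this

theorem arc_nonneg (x : ZMod N) (η : Config N) (y : ZMod N) : 0 ≤ arc x η y :=
  (occ_nonneg η y).trans (occ_le_arc x η y)

theorem arc_le_total (x : ZMod N) (η : Config N) (y : ZMod N) : arc x η y ≤ total η :=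
  Finset.sum_le_sum fun z _ => by split_ifs; exacts [le_rfl, occ_nonneg η z]

theorem total_le (η : Config N) : total η ≤ N := by
  calc total η ≤ ∑ _z : ZMod N, (1 : ℝ) := Finset.sum_le_sum fun z _ => occ_le_one η z
    _ = N := by simp [ZMod.card]

theorem total_exchange (η : Config N) (z : ZMod N) : total (exchange η z) = total η :=
  Equiv.sum_comp (Equiv.swap z (z + 1)) (occ η)

theorem numParticles_eq_total (η : Config N) : (numParticles η : ℝ) = total η := by
  simp [numParticles, total, occ]

theorem sum_add_one (f : ZMod N → ℝ) : ∑ z, f (z + 1) = ∑ z, f z :=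
  Equiv.sum_comp (Equiv.addRight (1 : ZMod N)) f

/-- Unless `y = z`, the sites `z` and `z + 1` are both inside or both outside the arc; `z ≠ x` keeps
the exchange from crossing the cut. -/
theorem arc_exchange {x z y : ZMod N} (η : Config N) (hz : z ≠ x) (hy : y ≠ z) :
    arc x (exchange η z) y = arc x η y := by
  have hp := pos_add_one hz
  have hne : pos x y ≠ pos x z := fun h => hy (pos_injective x h)
  unfold arc
  rw [← Equiv.sum_comp (Equiv.swap z (z + 1))]
  refine Finset.sum_congr rfl fun w _ => ?_
  have ho : occ (exchange η z) (Equiv.swap z (z + 1) w) = occ η w := by simp [occ, exchange]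
  rw [ho]
  congr 1
  rw [eq_iff_iff]
  by_cases h1 : w = z
  · subst h1; rw [Equiv.swap_apply_left, hp]; omega
  · by_cases h2 : w = z + 1
    · subst h2; rw [Equiv.swap_apply_right, hp]; omega
    · rw [Equiv.swap_apply_of_ne_of_ne h1 h2]

/-! ### The Lyapunov function -/

/-- The contribution of a pair of particles at `y`, `y + 1`: the number of particles on the arc
from `x + 1` to `y` times that on the complementary arc. -/
noncomputable def pairWeight (x : ZMod N) (η : Config N) (y : ZMod N) : ℝ :=
  occ η y * occ η (y + 1) * (arc x η y * (total η - arc x η y))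

noncomputable def pairSum (x : ZMod N) (η : Config N) : ℝ := ∑ y : ZMod N, pairWeight x η y

noncomputable def trapEnergy (x : ZMod N) (η : Config N) : ℝ := trap x η * pairSum x η

noncomputable def lyapunov (η : Config N) : ℝ := ∑ x : ZMod N, trapEnergy x η

theorem arc_mul_nonneg (x : ZMod N) (η : Config N) (y : ZMod N) :
    0 ≤ arc x η y * (total η - arc x η y) :=
  mul_nonneg (arc_nonneg x η y) (sub_nonneg.2 (arc_le_total x η y))

theorem arc_mul_le (x : ZMod N) (η : Config N) (y : ZMod N) :
    arc x η y * (total η - arc x η y) ≤ (N : ℝ) ^ 2 := by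
  rw [sq]
  exact mul_le_mul ((arc_le_total x η y).trans (total_le η))
    ((sub_le_self _ (arc_nonneg x η y)).trans (total_le η))
    (sub_nonneg.2 (arc_le_total x η y)) (Nat.cast_nonneg N)

theorem pairWeight_nonneg (x : ZMod N) (η : Config N) (y : ZMod N) : 0 ≤ pairWeight x η y :=
  mul_nonneg (occ_mul_nonneg η y) (arc_mul_nonneg x η y)

theorem pairSum_nonneg (x : ZMod N) (η : Config N) : 0 ≤ pairSum x η :=
  Finset.sum_nonneg fun y _ => pairWeight_nonneg x η y

theorem trapEnergy_nonneg (x : ZMod N) (η : Config N) : 0 ≤ trapEnergy x η := by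
  rcases trap_mem x η with h | h <;> simp [trapEnergy, h, pairSum_nonneg]

theorem trapEnergy_le (x : ZMod N) (η : Config N) : trapEnergy x η ≤ (N : ℝ) ^ 3 := by
  have h1 : pairSum x η ≤ (N : ℝ) ^ 3 := by
    calc pairSum x η ≤ ∑ _y : ZMod N, (N : ℝ) ^ 2 := Finset.sum_le_sum fun y _ =>
          (mul_le_of_le_one_left (arc_mul_nonneg x η y) (occ_mul_le_one η y)).trans
            (arc_mul_le x η y)
      _ = (N : ℝ) ^ 3 := by simp [ZMod.card]; ring
  rcases trap_mem x η with h | h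
  · simp [trapEnergy, h]
  · simpa [trapEnergy, h] using h1

theorem lyapunov_nonneg (η : Config N) : 0 ≤ lyapunov η :=
  Finset.sum_nonneg fun x _ => trapEnergy_nonneg x η

theorem lyapunov_le (η : Config N) : lyapunov η ≤ (N : ℝ) ^ 4 := by
  calc lyapunov η ≤ ∑ _x : ZMod N, (N : ℝ) ^ 3 := Finset.sum_le_sum fun x _ => trapEnergy_le x η
    _ = (N : ℝ) ^ 4 := by simp [ZMod.card]; ring

/-! ### The drift of the Lyapunov function -/

/-- With a = `arc x η z`, the jump destroys the pair of index a - 1 and creates at most the one of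
index a. The bound is the difference of their weights. -/
theorem trapEnergy_exchange_sub_le_of_right {x z : ZMod N} {η : Config N} (hx : occ η x = 0)
    (hx' : occ η (x + 1) = 0) (h0 : occ η (z - 1) = 1) (h1 : occ η z = 1)
    (h2 : occ η (z + 1) = 0) :
    trapEnergy x (exchange η z) - trapEnergy x η ≤ total η + 1 - 2 * arc x η z := by
  have hzx : z ≠ x := fun h => by simp [h, hx] at h1
  have hzx' : z - 1 ≠ x := fun h => by simp [h, hx] at h0
  have hz1 : z - 1 ≠ z + 1 := fun h => by simp [h, h2] at h0
  have hz0 : z - 1 ≠ z := fun h => by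
    have h' : z + 1 = z := by linear_combination -h
    rw [h', h1] at h2; exact one_ne_zero h2
  have hz2 : z + 1 ≠ z := fun h => by rw [h, h1] at h2; exact one_ne_zero h2
  have ha : arc x η z = arc x η (z - 1) + 1 := by
    have := arc_add_one η hzx'
    rw [sub_add_cancel, h1] at this; exact this
  have hw : pairWeight x η (z - 1) = (arc x η z - 1) * (total η - (arc x η z - 1)) := by
    rw [pairWeight, h0, sub_add_cancel, h1, ha]; ring
  have ht : trap x η = 1 := by simp [trap, hx, hx']
  have hk := arc_mul_nonneg x η z
  rcases trap_mem x (exchange η z) with h | h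
  -- If the jump fills the empty pair, the whole energy is lost, in particular the weight of the
  -- pair at `z - 1`.
  · have := Finset.single_le_sum (s := Finset.univ) (fun y _ => pairWeight_nonneg x η y)
      (Finset.mem_univ (z - 1))
    rw [hw] at this
    rw [trapEnergy, trapEnergy, h, ht, pairSum, pairSum]
    nlinarith
  · rw [trapEnergy, trapEnergy, h, ht, one_mul, one_mul, pairSum, pairSum,
      ← Finset.sum_sub_distrib]
    calc ∑ y, (pairWeight x (exchange η z) y - pairWeight x η y)
        ≤ ∑ y, ((if y = z + 1 then arc x η z * (total η - arc x η z) else 0)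
          - (if y = z - 1 then pairWeight x η (z - 1) else 0)) := by
          refine Finset.sum_le_sum fun y _ => ?_
          by_cases hy : y = z + 1
          · subst hy
            have hb : arc x η (z + 1) = arc x η z := by rw [arc_add_one η hzx, h2, add_zero]
            rw [if_pos rfl, if_neg hz1.symm, sub_zero]
            have e1 : pairWeight x η (z + 1) = 0 := by simp [pairWeight, h2]
            rw [e1, sub_zero, pairWeight, arc_exchange η hzx hz2, total_exchange, hb]
            exact mul_le_of_le_one_left hk (occ_mul_le_one _ _)
          · by_cases hy' : y = z - 1
            · subst hy'
              rw [if_neg hy, if_pos rfl]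
              have : pairWeight x (exchange η z) (z - 1) = 0 := by
                simp [pairWeight, occ_exchange_left, h2]
              rw [this]
            · rw [if_neg hy, if_neg hy', sub_zero]
              by_cases hyz : y = z
              · subst hyz
                simp [pairWeight, occ_exchange_left, h2]
              · rw [pairWeight, pairWeight, arc_exchange η hzx hyz, total_exchange,
                  occ_exchange_of_ne η hyz hy, occ_exchange_of_ne η
                    (fun h => hy' (eq_sub_of_add_eq h)) (fun h => hyz (add_right_cancel h)),
                  sub_self]
      _ = arc x η z * (total η - arc x η z) - pairWeight x η (z - 1) := by
          simp [Finset.sum_sub_distrib]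
      _ = total η + 1 - 2 * arc x η z := by rw [hw]; ring

/-- Mirror image: the pair of index a + 1 is destroyed, and at most the one of index a is created.
-/
theorem trapEnergy_exchange_sub_le_of_left {x z : ZMod N} {η : Config N} (hx : occ η x = 0)
    (hx' : occ η (x + 1) = 0) (h0 : occ η z = 0) (h1 : occ η (z + 1) = 1)
    (h2 : occ η (z + 2) = 1) :
    trapEnergy x (exchange η z) - trapEnergy x η ≤ 2 * arc x η z + 1 - total η := by
  have e2 : z + 1 + 1 = z + 2 := by ring
  have hzx : z ≠ x := fun h => by simp [h, hx'] at h1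
  have hz2 : z + 1 ≠ z := fun h => by rw [h, h0] at h1; exact zero_ne_one h1
  have hz0 : z - 1 ≠ z := fun h => hz2 (by linear_combination -h)
  have ha : arc x η (z + 1) = arc x η z + 1 := by rw [arc_add_one η hzx, h1]
  have hw : pairWeight x η (z + 1) = (arc x η z + 1) * (total η - (arc x η z + 1)) := by
    rw [pairWeight, h1, e2, h2, ha]; ring
  have ht : trap x η = 1 := by simp [trap, hx, hx']
  have hk := arc_mul_nonneg x η z
  rcases trap_mem x (exchange η z) with h | h
  · have := Finset.single_le_sum (s := Finset.univ) (fun y _ => pairWeight_nonneg x η y)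
      (Finset.mem_univ (z + 1))
    rw [hw] at this
    rw [trapEnergy, trapEnergy, h, ht, pairSum, pairSum]
    nlinarith
  · rw [trapEnergy, trapEnergy, h, ht, one_mul, one_mul, pairSum, pairSum,
      ← Finset.sum_sub_distrib]
    calc ∑ y, (pairWeight x (exchange η z) y - pairWeight x η y)
        ≤ ∑ y, ((if y = z - 1 then arc x η z * (total η - arc x η z) else 0)
          - (if y = z + 1 then pairWeight x η (z + 1) else 0)) := by
          refine Finset.sum_le_sum fun y _ => ?_
          by_cases hy : y = z + 1
          · subst hy
            have e1 : pairWeight x (exchange η z) (z + 1) = 0 := by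
              simp [pairWeight, occ_exchange_right, h0]
            rw [if_pos rfl, e1]
            refine sub_le_sub_right ?_ _
            split_ifs
            exacts [hk, le_rfl]
          · rw [if_neg hy, sub_zero]
            by_cases hy' : y = z - 1
            · subst hy'
              have e1 : pairWeight x η (z - 1) = 0 := by simp [pairWeight, h0]
              rw [if_pos rfl, e1, sub_zero]
              by_cases hzx' : z - 1 = x
              · have e3 : occ (exchange η z) (z - 1) = 0 := by
                  rw [occ_exchange_of_ne η hz0 hy, hzx', hx]
                rw [pairWeight, e3, zero_mul, zero_mul]
                exact hk
              · have hb : arc x η z = arc x η (z - 1) := by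
                  have := arc_add_one η hzx'
                  rwa [sub_add_cancel, h0, add_zero] at this
                rw [pairWeight, arc_exchange η hzx hz0, total_exchange, ← hb]
                exact mul_le_of_le_one_left hk (occ_mul_le_one _ _)
            · rw [if_neg hy']
              by_cases hyz : y = z
              · subst hyz
                simp [pairWeight, occ_exchange_right, h0]
              · rw [pairWeight, pairWeight, arc_exchange η hzx hyz, total_exchange,
                  occ_exchange_of_ne η hyz hy, occ_exchange_of_ne η
                    (fun h => hy' (eq_sub_of_add_eq h)) (fun h => hyz (add_right_cancel h)),
                  sub_self]
      _ = arc x η z * (total η - arc x η z) - pairWeight x η (z + 1) := by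
          simp [Finset.sum_sub_distrib]
      _ = 2 * arc x η z + 1 - total η := by rw [hw]; ring

/-- Inside a run of adjacent pairs no jump occurs; the first differences of the weight at the ends
of the run telescope to -2 per pair. -/
theorem sum_drift {x : ZMod N} {η : Config N} (hx : occ η x = 0) (hx' : occ η (x + 1) = 0) :
    ∑ z, (occ η (z - 1) * occ η z * (1 - occ η (z + 1)) * (total η + 1 - 2 * arc x η z)
      + (1 - occ η z) * occ η (z + 1) * occ η (z + 2) * (2 * arc x η z + 1 - total η))
      = -2 * ∑ z, occ η z * occ η (z + 1) := by
  have e2 : ∀ z : ZMod N, z + 1 + 1 = z + 2 := fun z => by ring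
  -- For a pair of index k, `c` carries 2k - 1 - T, the weight at k - 1 minus the weight at k. The
  -- arc count resets past `x`, but there every term has the factor `occ η (x + 1) = 0`.
  set c : ZMod N → ℝ := fun z => occ η z * occ η (z + 1) * (2 * arc x η z - 1 - total η) with hc
  have key : ∀ z, occ η z * occ η (z + 1) * (1 - occ η (z + 2))
        * (total η + 1 - 2 * arc x η (z + 1))
      + (1 - occ η z) * occ η (z + 1) * occ η (z + 2) * (2 * arc x η z + 1 - total η)
      = -2 * (occ η z * occ η (z + 1)) + (c (z + 1) - c z) := fun z => by
    simp only [hc, e2]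
    by_cases hz : z = x
    · subst hz; simp [hx']
    · rw [arc_add_one η hz]
      rcases occ_mem η (z + 1) with h | h
      · simp [h]
      · rw [h]; ring
  rw [Finset.sum_add_distrib,
    ← sum_add_one fun z =>
      occ η (z - 1) * occ η z * (1 - occ η (z + 1)) * (total η + 1 - 2 * arc x η z),
    ← Finset.sum_add_distrib]
  simp only [add_sub_cancel_right, e2]
  rw [Finset.sum_congr rfl fun z _ => key z, Finset.sum_add_distrib, Finset.sum_sub_distrib,
    sum_add_one c, sub_self, add_zero, Finset.mul_sum]

theorem pairSum_le (x : ZMod N) (η : Config N) :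
    pairSum x η ≤ (N : ℝ) ^ 2 * ∑ y, occ η y * occ η (y + 1) := by
  rw [pairSum, Finset.mul_sum]
  refine Finset.sum_le_sum fun y _ => ?_
  rw [pairWeight, mul_comm ((N : ℝ) ^ 2)]
  exact mul_le_mul_of_nonneg_left (arc_mul_le x η y) (occ_mul_nonneg η y)

theorem generator_trapEnergy_le (x : ZMod N) (η : Config N) :
    generator N (trapEnergy x) η ≤ -(2 / (N : ℝ) ^ 2) * trapEnergy x η := by
  have hN : (0 : ℝ) < (N : ℝ) ^ 2 := by
    have := NeZero.pos N
    positivity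
  change ∑ z, rate η z * (trapEnergy x (exchange η z) - trapEnergy x η) ≤ _
  rcases trap_mem x η with ht | ht
  · have h0 : trapEnergy x η = 0 := by rw [trapEnergy, ht, zero_mul]
    rw [h0, mul_zero]
    refine Finset.sum_nonpos fun z _ => ?_
    have h := rate_mul_le (η := η) (z := z) (d := trapEnergy x (exchange η z) - 0) (a := 0)
      (b := 0)
      (fun h1 h2 h3 => by rw [trapEnergy, trap_exchange_eq_zero ht (Or.inl ⟨h1, h2, h3⟩)]; simp)
      (fun h1 h2 h3 => by rw [trapEnergy, trap_exchange_eq_zero ht (Or.inr ⟨h1, h2, h3⟩)]; simp)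
    simpa using h
  · have hx : occ η x = 0 := by
      rcases occ_mem η x with h | h
      · exact h
      · simp [trap, h] at ht
    have hx' : occ η (x + 1) = 0 := by
      rcases occ_mem η (x + 1) with h | h
      · exact h
      · simp [trap, h] at ht
    calc _ ≤ _ := Finset.sum_le_sum fun z _ => rate_mul_le
            (trapEnergy_exchange_sub_le_of_right (z := z) hx hx')
            (trapEnergy_exchange_sub_le_of_left hx hx')
      _ = -2 * ∑ z, occ η z * occ η (z + 1) := sum_drift hx hx'
      _ = -(2 / (N : ℝ) ^ 2) * ((N : ℝ) ^ 2 * ∑ z, occ η z * occ η (z + 1)) := by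
          rw [← mul_assoc, neg_mul (2 / (N : ℝ) ^ 2), div_mul_cancel₀ _ hN.ne']
      _ ≤ _ := by
          rw [trapEnergy, ht, one_mul]
          exact mul_le_mul_of_nonpos_left (pairSum_le x η) (neg_nonpos.2 (by positivity))

theorem generator_lyapunov_le (η : Config N) :
    generator N lyapunov η ≤ -(2 / (N : ℝ) ^ 2) * lyapunov η := by
  have h : (lyapunov : Config N → ℝ) = ∑ x : ZMod N, trapEnergy x := by
    ext ζ; simp [lyapunov]
  rw [h, map_sum, Finset.sum_apply, Finset.sum_apply, Finset.mul_sum]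
  exact Finset.sum_le_sum fun x _ => generator_trapEnergy_le x η

/-! ### Transient configurations -/

/-- At density at most 1/2 a particle pair therefore forces an empty pair, and at density at least
1/2 conversely. -/
theorem sum_occ_mul_sub_sum_trap (η : Config N) :
    ∑ y, occ η y * occ η (y + 1) - ∑ x, trap x η = 2 * total η - N := by
  have h : ∀ y, occ η y * occ η (y + 1) - trap y η = occ η y + occ η (y + 1) - 1 :=
    fun y => by unfold trap; ring
  rw [← Finset.sum_sub_distrib, Finset.sum_congr rfl fun y _ => h y, Finset.sum_sub_distrib,
    Finset.sum_add_distrib, sum_add_one (occ η)]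
  simp [total, ZMod.card]
  ring

/-- A transient configuration has both a pair of neighbouring particles and a pair of neighbouring
empty sites. -/
theorem exists_pair_trap_of_mem_transient {η : Config N} (h : η ∈ transient N) :
    (∃ y, occ η y = 1 ∧ occ η (y + 1) = 1) ∧ ∃ x, trap x η = 1 := by
  have hsum := sum_occ_mul_sub_sum_trap η
  have hp : (0 < ∑ y, occ η y * occ η (y + 1)) ∧ 0 < ∑ x, trap x η := by
    rcases h with ⟨h1, h2⟩ | ⟨h1, h2⟩
    · have : 0 < ∑ y, occ η y * occ η (y + 1) := by
        obtain ⟨y, hy⟩ := not_forall.1 h1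
        exact Finset.sum_pos' (fun y _ => occ_mul_nonneg η y)
          ⟨y, Finset.mem_univ y, lt_of_le_of_ne (occ_mul_nonneg η y) (Ne.symm hy)⟩
      rw [numParticles_eq_total] at h2
      exact ⟨this, by linarith⟩
    · have : 0 < ∑ x, trap x η := by
        obtain ⟨x, hx⟩ := not_forall.1 h1
        exact Finset.sum_pos' (fun x _ => trap_nonneg x η)
          ⟨x, Finset.mem_univ x, lt_of_le_of_ne (trap_nonneg x η) (Ne.symm hx)⟩
      rw [numParticles_eq_total] at h2
      exact ⟨by linarith, this⟩
  constructor
  · obtain ⟨y, -, hy⟩ := Finset.exists_ne_zero_of_sum_ne_zero hp.1.ne'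
    exact ⟨y, (occ_mem η y).resolve_left (left_ne_zero_of_mul hy),
      (occ_mem η (y + 1)).resolve_left (right_ne_zero_of_mul hy)⟩
  · obtain ⟨x, -, hx⟩ := Finset.exists_ne_zero_of_sum_ne_zero hp.2.ne'
    exact ⟨x, (trap_mem x η).resolve_left hx⟩

theorem one_le_lyapunov {η : Config N} (h : η ∈ transient N) : 1 ≤ lyapunov η := by
  obtain ⟨⟨y, hy, hy'⟩, x, ht⟩ := exists_pair_trap_of_mem_transient h
  have hyx : y ≠ x := fun h => by simp [trap, ← h, hy] at ht
  have h1 : 1 ≤ arc x η y := hy.symm.le.trans (occ_le_arc x η y)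
  -- The particle at `y + 1` lies beyond the arc, because `y` is not the cut.
  have h2 : 1 ≤ total η - arc x η y := by
    have := arc_le_total x η (y + 1)
    rw [arc_add_one η hyx, hy'] at this
    linarith
  calc (1 : ℝ) ≤ pairWeight x η y := by
        rw [pairWeight, hy, hy', one_mul, one_mul]
        exact one_le_mul_of_one_le_of_one_le h1 h2
    _ ≤ pairSum x η :=
        Finset.single_le_sum (fun y _ => pairWeight_nonneg x η y) (Finset.mem_univ y)
    _ = trapEnergy x η := by rw [trapEnergy, ht, one_mul]
    _ ≤ lyapunov η :=
        Finset.single_le_sum (fun x _ => trapEnergy_nonneg x η) (Finset.mem_univ x)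

/-! ### Decay of the transience probability -/

variable (N) in
theorem maxTransienceProb_le {t : ℝ} (ht : 0 ≤ t) :
    maxTransienceProb N t ≤
      ENNReal.ofReal (Real.exp (-(2 / (N : ℝ) ^ 2) * t) * (N : ℝ) ^ 4) := by
  refine iSup_le fun η => (law_le_ofReal_semigroup ht η lyapunov_nonneg
    fun ζ hζ => one_le_lyapunov hζ).trans (ENNReal.ofReal_le_ofReal ?_)
  exact (semigroup_le_exp_mul generator_lyapunov_le ht η).trans
    (mul_le_mul_of_nonneg_left (lyapunov_le η) (Real.exp_pos _).le)

end Occ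

theorem maxTransienceProb_log_scale_le {N : ℕ} [NeZero N] (hN : 2 ≤ N) {t : ℝ} (ht : 2 ≤ t) :
    maxTransienceProb N (t * (N : ℝ) ^ 2 * Real.log N) ≤
      ENNReal.ofReal (Real.exp ((4 - 2 * t) * Real.log 2)) := by
  have hN' : (2 : ℝ) ≤ N := by exact_mod_cast hN
  have hlog : Real.log 2 ≤ Real.log N := Real.log_le_log two_pos hN'
  have hlog0 : 0 < Real.log 2 := Real.log_pos one_lt_two
  refine (maxTransienceProb_le N (by positivity)).trans (ENNReal.ofReal_le_ofReal ?_)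
  have h4 : (N : ℝ) ^ 4 = Real.exp (4 * Real.log N) := by
    rw [mul_comm, Real.exp_mul, Real.exp_log (by linarith)]
    norm_cast
  rw [h4, ← Real.exp_add]
  refine Real.exp_le_exp.2 ?_
  have : -(2 / (N : ℝ) ^ 2) * (t * (N : ℝ) ^ 2 * Real.log N) + 4 * Real.log N
      = (4 - 2 * t) * Real.log N := by
    have : (N : ℝ) ≠ 0 := by linarith
    field_simp
    ring
  rw [this]
  -- For `t ≥ 2` the exponent 4 - 2t is nonpositive, so `N = 2` is the worst case and the bound is
  -- uniform in `N`.
  exact mul_le_mul_of_nonpos_left hlog (by linarith)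

end FEP

theorem theorem2p1 :
    Tendsto
      (fun t : ℝ => ⨆ N : {n : ℕ // 2 ≤ n},
        FEP.maxTransienceProb (N : ℕ) (t * ((N : ℕ) : ℝ) ^ 2 * Real.log ((N : ℕ) : ℝ)))
      atTop (𝓝 0) := by
  have h : Tendsto (fun t : ℝ => ENNReal.ofReal (Real.exp ((4 - 2 * t) * Real.log 2))) atTop
      (𝓝 0) := by
    rw [← ENNReal.ofReal_zero]
    refine ENNReal.tendsto_ofReal (Real.tendsto_exp_atBot.comp ?_)
    refine Tendsto.atBot_mul_const (Real.log_pos one_lt_two) ?_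
    simp only [sub_eq_add_neg]
    exact tendsto_atBot_add_const_left _ _
      (tendsto_neg_atTop_atBot.comp (tendsto_id.const_mul_atTop two_pos))
  refine tendsto_of_tendsto_of_tendsto_of_le_of_le' tendsto_const_nhds h
    (Eventually.of_forall fun _ => zero_le) ?_
  filter_upwards [eventually_ge_atTop 2] with t ht
  exact iSup_le fun N => FEP.maxTransienceProb_log_scale_le N.2 ht
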